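/- Let $m,n\ge 0$ be integers, $D=(0,1)\times(-1,1)^n\subset\mathbb{R}\times\mathbb{R}^n$ with points written $(x,z)$, and let $f,g$ be real-valued functions that are real-analytic on a neighbourhood of the compact set $\overline{D}$. For real $N$ set $$I(N)=\int_{D} x^m\, g(x,z)\, e^{N f(x,z)}\,dx\,dz .$$ Write $f_x=\frac{\partial f}{\partial x}(0,0)$, $f_{zz}=\frac{\partial^2 f}{\partial z^2}(0,0)$ and $g_{zz}=\frac{\partial^2 g}{\partial z^2}(0,0)$ (the $n\times n$ Hessian matrices in $z$). Assume that $f$ has a unique maximum on $\overline{D}$, attained at $(0,0)$, that $f_{zz}$ is negative definite, and that $f_x<0$. Then the integrand is integrable on $D$ for every $N$, and the following hold as $N\to+\infty$. 1. If $g(0,0)\neq 0$, then $$I(N)=\frac{g(0,0)\,m!\,(2\pi)^{n/2}\,e^{N f(0,0)}\,N^{-m-n/2-1}}{\sqrt{|\det f_{zz}|}\,(-f_x)^{m+1}}+O\!\left(e^{N f(0,0)}N^{-m-n/2-2}\right).$$ 2. If $g(0,0)=0$, $\frac{\partial g}{\partial x}(0,0)=0$ and $\frac{\partial g}{\partial z}(0,0)=0$,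 then $$I(N)=\frac{\operatorname{tr}\!\left(-g_{zz}\,f_{zz}^{-1}\right)m!\,(2\pi)^{n/2}}{2\sqrt{|\det f_{zz}|}\,(-f_x)^{m+1}}\,e^{N f(0,0)}\,N^{-m-n/2-2}+O\!\left(e^{N f(0,0)}N^{-m-n/2-3}\right).$$ (For $n=0$ there are no $z$ variables, the determinant is $1$ and the trace is $0$.) -/

import Mathlib

open Filter Asymptotics MeasureTheory
open scoped Nat

namespace HalfSpaceLaplace

/-- The domain `(0,1) × (-1,1)^n`, a subset of `ℝ × ℝ^n`; points are `p = (x, z)`. -/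
def domain (n : ℕ) : Set (ℝ × (Fin n → ℝ)) :=
  Set.Ioo (0 : ℝ) 1 ×ˢ Set.univ.pi (fun _ : Fin n => Set.Ioo (-1 : ℝ) 1)

/-- The integrand `x^m g(x,z) exp(N f(x,z))`. -/
noncomputable def integrand {n : ℕ} (m : ℕ) (f g : ℝ × (Fin n → ℝ) → ℝ) (N : ℝ)
    (p : ℝ × (Fin n → ℝ)) : ℝ :=
  p.1 ^ m * g p * Real.exp (N * f p)

/-- The Laplace integral of `x^m g(x,z) exp(N f(x,z))` over `(0,1) × (-1,1)^n`
with respect to Lebesgue measure. -/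
noncomputable def laplaceIntegral {n : ℕ} (m : ℕ) (f g : ℝ × (Fin n → ℝ) → ℝ) (N : ℝ) : ℝ :=
  ∫ p in domain n, integrand m f g N p

/-- The partial derivative `∂f/∂x` at `p`. -/
noncomputable def partialX {n : ℕ} (f : ℝ × (Fin n → ℝ) → ℝ) (p : ℝ × (Fin n → ℝ)) : ℝ :=
  fderiv ℝ f p (1, 0)

/-- The partial derivative `∂f/∂z_i` at `p`. -/
noncomputable def partialZ {n : ℕ} (i : Fin n) (f : ℝ × (Fin n → ℝ) → ℝ)
    (p : ℝ × (Fin n → ℝ)) : ℝ :=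
  fderiv ℝ f p (0, Pi.single i 1)

/-- The Hessian matrix `∂²f/∂z²` at `p`, with entries `∂/∂z_i (∂f/∂z_j)`. -/
noncomputable def hessianZ {n : ℕ} (f : ℝ × (Fin n → ℝ) → ℝ) (p : ℝ × (Fin n → ℝ)) :
    Matrix (Fin n) (Fin n) ℝ :=
  Matrix.of fun i j => partialZ i (partialZ j f) p

end HalfSpaceLaplace

/-!
Normalise `f (0, 0) = 0`, and put `a = -∂f/∂x` and `A = -f_zz`. Since the maximum is interior in the
directions `z`, the gradient `∂f/∂z` vanishes at the origin. Give `x` weight two and `z` weight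
one, and write `σ = √(x + |z|²)` (`pGauge`). The leading part of the phase is
`F₀ = -(a x + zᵀ A z / 2)`, of weight two. In weight three only monomials `x z_i` and `z_i z_j z_k`
occur, so the next part `C` of the phase is odd in `z`, and `|f - F₀ - C|` is at most a multiple of
`σ⁴` on the whole compact domain (`exists_expansion_four`). In the same way the amplitude `g` has a
leading part `G`, even in `z` and of weight `2 k`, followed by a part `O` which is odd in `z` and of
weight `2 k + 1`, and `|g - G - O|` is at most a multiple of `σ^(2 k + 2)`. Here `k = 0` and `G = g
(0, 0)` in general, while `k = 1` and `G = zᵀ g_zz z / 2` if `g` and its gradient vanish at the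
origin.

Both `f` and `F₀` are at most `-c σ²` (`exists_le_neg_mul_gauge_sq`), so expanding the exponential
shows that `g e^(N f)` differs from `G e^(N F₀) + (O + N G C) e^(N F₀)` by at most a multiple of
`N^(-k-1) e^(-c N σ² / 2)`. The second term is odd in `z` and integrates to zero over the symmetric
domain, and the error, times `x^m`, integrates to a multiple of `N^(-k-1) N^(-m-1-n/2)`. Outside the
domain `σ ≥ 1`, so `G e^(N F₀)` obeys the same error bound there and may be integrated over the
whole half space `x > 0` (`exists_abs_integral_sub_le`). The remaining integral splits into a Gamma
integral in `x` and a Gaussian moment in `z`; writing `A = MᵀM` and substituting `w = M z` reduces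
the latter to one dimensional Gaussian moments (`integral_exp_quadratic`,
`integral_quadratic_mul_exp_quadratic`).
-/

namespace HalfSpaceLaplace

/-! ### Gaussian moments on `ℝ^n` -/

open Matrix in
/-- A positive definite real matrix is `MᵀM` with `M` invertible. -/
lemma exists_transpose_mul_self {n : ℕ} {A : Matrix (Fin n) (Fin n) ℝ} (hA : A.PosDef) :
    ∃ M : Matrix (Fin n) (Fin n) ℝ, M.det ≠ 0 ∧ A = Mᵀ * M := by
  open scoped MatrixOrder ComplexOrder in
  obtain ⟨M, hM⟩ := CStarAlgebra.nonneg_iff_eq_star_mul_self.mp hA.posSemidef.nonneg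
  have hM' : A = Mᵀ * M := by
    rw [hM, star_eq_conjTranspose, conjTranspose_eq_transpose_of_trivial]
  refine ⟨M, fun h => ?_, hM'⟩
  have := hA.det_pos
  rw [hM', det_mul, h] at this
  simp at this

open Matrix in
lemma dotProduct_transpose_mul_self {n : ℕ} (M : Matrix (Fin n) (Fin n) ℝ) (z : Fin n → ℝ) :
    z ⬝ᵥ (Mᵀ * M) *ᵥ z = ∑ i, (M *ᵥ z) i ^ 2 := by
  rw [← mulVec_mulVec, dotProduct_mulVec, vecMul_transpose, dotProduct]
  exact Finset.sum_congr rfl fun i _ => (sq _).symm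

lemma integral_comp_mulVec {n : ℕ} {M : Matrix (Fin n) (Fin n) ℝ} (hM : M.det ≠ 0)
    (F : (Fin n → ℝ) → ℝ) :
    ∫ z, F (M.mulVec z) = |M.det|⁻¹ * ∫ w, F w := by
  have hdet : LinearMap.det (Matrix.toLin' M) ≠ 0 := by rwa [LinearMap.det_toLin']
  have hmap := Measure.map_linearMap_addHaar_pi_eq_smul_addHaar hdet
    (volume : Measure (Fin n → ℝ))
  have hemb : MeasurableEmbedding (Matrix.toLin' M) := by
    have := (LinearEquiv.ofIsUnitDet (f := Matrix.toLin' M)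
      (v := Pi.basisFun ℝ (Fin n)) (v' := Pi.basisFun ℝ (Fin n)) (by
        rw [← Matrix.toLin_eq_toLin', LinearMap.toMatrix_toLin]
        exact isUnit_iff_ne_zero.mpr hM)).toContinuousLinearEquiv.toHomeomorph.measurableEmbedding
    exact this
  have := hemb.integral_map (μ := volume) F
  rw [hmap, integral_smul_measure, LinearMap.det_toLin'] at this
  simp only [Matrix.toLin'_apply] at this
  rw [← this, ENNReal.toReal_ofReal (abs_nonneg _), abs_inv, smul_eq_mul]

lemma integral_sq_mul_exp_neg_mul_sq {b : ℝ} (hb : 0 < b) :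
    ∫ x : ℝ, x ^ 2 * Real.exp (-b * x ^ 2) = √(Real.pi / b) / (2 * b) := by
  have h1 := integral_comp_abs (f := fun x : ℝ => x ^ 2 * Real.exp (-b * x ^ 2))
  simp only [sq_abs] at h1
  have h2 := integral_rpow_mul_exp_neg_mul_rpow (p := 2) (q := 2) (b := b) (by norm_num)
    (by norm_num) hb
  simp only [Real.rpow_two] at h2
  rw [h1, h2]
  have h3 : Real.Gamma ((2 + 1) / 2) = 1 / 2 * √Real.pi := by
    rw [show ((2 + 1) / 2 : ℝ) = 1 / 2 + 1 by norm_num, Real.Gamma_add_one (by norm_num),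
      Real.Gamma_one_half_eq]
  have h4 : b ^ (-(2 + 1) / 2 : ℝ) = (√b)⁻¹ * b⁻¹ := by
    rw [Real.sqrt_eq_rpow, ← Real.rpow_neg hb.le, ← Real.rpow_neg_one b, ← Real.rpow_add hb]
    norm_num
  rw [h3, h4, Real.sqrt_div Real.pi_pos.le]
  field_simp

lemma integral_id_mul_exp_neg_mul_sq (b : ℝ) :
    ∫ x : ℝ, x * Real.exp (-b * x ^ 2) = 0 := by
  have h := integral_neg_eq_self (fun x : ℝ => x * Real.exp (-b * x ^ 2)) volume
  simp only [neg_sq, neg_mul, integral_neg] at h ⊢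
  linarith

lemma integrable_pow_mul_exp_neg_mul_sq {b : ℝ} (hb : 0 < b) (k : ℕ) :
    Integrable fun x : ℝ => x ^ k * Real.exp (-b * x ^ 2) := by
  simpa using integrable_rpow_mul_exp_neg_mul_sq hb
    (s := k) (lt_of_lt_of_le (by norm_num) (Nat.cast_nonneg k))

lemma mul_exp_neg_sum_sq_eq_prod {n : ℕ} (b : ℝ) (i j : Fin n) (w : Fin n → ℝ) :
    w i * w j * Real.exp (-b * ∑ k, w k ^ 2) =
      ∏ k, w k ^ ((if k = i then 1 else 0) + if k = j then 1 else 0) *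
        Real.exp (-b * w k ^ 2) := by
  rw [Finset.prod_mul_distrib, ← Real.exp_sum, Finset.mul_sum]
  simp only [pow_add, Finset.prod_mul_distrib, pow_ite, pow_one, pow_zero,
    Finset.prod_ite_eq', Finset.mem_univ, if_true]

lemma exp_neg_sum_sq_eq_prod {n : ℕ} (b : ℝ) (w : Fin n → ℝ) :
    Real.exp (-b * ∑ k, w k ^ 2) = ∏ k, Real.exp (-b * w k ^ 2) := by
  rw [← Real.exp_sum, Finset.mul_sum]

lemma integrable_exp_neg_sum_sq {n : ℕ} {b : ℝ} (hb : 0 < b) :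
    Integrable fun w : Fin n → ℝ => Real.exp (-b * ∑ k, w k ^ 2) := by
  simp only [exp_neg_sum_sq_eq_prod]
  exact Integrable.fintype_prod fun _ => integrable_exp_neg_mul_sq hb

lemma integral_exp_neg_sum_sq {n : ℕ} (b : ℝ) :
    ∫ w : Fin n → ℝ, Real.exp (-b * ∑ k, w k ^ 2) = √(Real.pi / b) ^ n := by
  simp only [exp_neg_sum_sq_eq_prod]
  rw [integral_fintype_prod_volume_eq_prod (fun _ x => Real.exp (-b * x ^ 2))]
  rw [Finset.prod_const, integral_gaussian, Finset.card_univ, Fintype.card_fin]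

lemma integrable_mul_exp_neg_sum_sq {n : ℕ} {b : ℝ} (hb : 0 < b) (i j : Fin n) :
    Integrable fun w : Fin n → ℝ => w i * w j * Real.exp (-b * ∑ k, w k ^ 2) := by
  simp only [mul_exp_neg_sum_sq_eq_prod]
  exact Integrable.fintype_prod
    (f := fun k x => x ^ ((if k = i then 1 else 0) + if k = j then 1 else 0) *
      Real.exp (-b * x ^ 2))
    fun k => integrable_pow_mul_exp_neg_mul_sq hb _

lemma integral_mul_exp_neg_sum_sq {n : ℕ} {b : ℝ} (hb : 0 < b) (i j : Fin n) :
    ∫ w : Fin n → ℝ, w i * w j * Real.exp (-b * ∑ k, w k ^ 2) =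
      if i = j then √(Real.pi / b) ^ n / (2 * b) else 0 := by
  simp only [mul_exp_neg_sum_sq_eq_prod]
  rw [integral_fintype_prod_volume_eq_prod (fun k x =>
    x ^ ((if k = i then 1 else 0) + if k = j then 1 else 0) * Real.exp (-b * x ^ 2))]
  split_ifs with hij
  · subst hij
    have : ∀ k : Fin n, (∫ x : ℝ, x ^ ((if k = i then 1 else 0) + if k = i then 1 else 0) *
        Real.exp (-b * x ^ 2)) = √(Real.pi / b) * if k = i then (2 * b)⁻¹ else 1 := by
      intro k
      split_ifs with h
      · simpa [div_eq_mul_inv] using integral_sq_mul_exp_neg_mul_sq hb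
      · simpa using integral_gaussian b
    simp only [this, Finset.prod_mul_distrib, Finset.prod_ite_eq', Finset.mem_univ, if_true,
      Finset.prod_const, Finset.card_univ, Fintype.card_fin, div_eq_mul_inv]
  · refine Finset.prod_eq_zero (Finset.mem_univ i) ?_
    simpa [hij] using integral_id_mul_exp_neg_mul_sq b

open Matrix in
lemma quadratic_eq_sum {n : ℕ} (B : Matrix (Fin n) (Fin n) ℝ) (z : Fin n → ℝ) :
    z ⬝ᵥ B *ᵥ z = ∑ i, ∑ j, B i j * (z i * z j) := by
  simp only [dotProduct, mulVec, Finset.mul_sum]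
  exact Finset.sum_congr rfl fun i _ => Finset.sum_congr rfl fun j _ => by ring

open Matrix in
lemma integral_quadratic_mul_exp {n : ℕ} {b : ℝ} (hb : 0 < b)
    (B : Matrix (Fin n) (Fin n) ℝ) :
    ∫ w : Fin n → ℝ, (w ⬝ᵥ B *ᵥ w) * Real.exp (-b * ∑ k, w k ^ 2) =
      B.trace * (√(Real.pi / b) ^ n / (2 * b)) := by
  have hint : ∀ i j, Integrable fun w : Fin n → ℝ =>
      B i j * (w i * w j * Real.exp (-b * ∑ k, w k ^ 2)) :=
    fun i j => (integrable_mul_exp_neg_sum_sq hb i j).const_mul (B i j)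
  simp only [quadratic_eq_sum, Finset.sum_mul]
  simp only [mul_assoc] at hint ⊢
  rw [integral_finsetSum _ fun i _ => integrable_finsetSum _ fun j _ => hint i j]
  simp_rw [integral_finsetSum _ fun j _ => hint _ j, integral_const_mul, ← mul_assoc,
    integral_mul_exp_neg_sum_sq hb, mul_ite, mul_zero, Finset.sum_ite_eq, Finset.mem_univ,
    if_true, ← Finset.sum_mul, Matrix.trace, Matrix.diag]

lemma sqrt_two_pi_div_pow {N : ℝ} (hN : 0 < N) (n : ℕ) :
    √(Real.pi / (N / 2)) ^ n = (2 * Real.pi) ^ ((n : ℝ) / 2) * N ^ (-((n : ℝ) / 2)) := by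
  have hπ := Real.pi_pos
  rw [show Real.pi / (N / 2) = 2 * Real.pi * N⁻¹ by field_simp, Real.sqrt_eq_rpow,
    ← Real.rpow_natCast, ← Real.rpow_mul (by positivity),
    Real.mul_rpow (by positivity) (by positivity), Real.inv_rpow hN.le, ← Real.rpow_neg hN.le]
  ring_nf

open Matrix in
lemma integral_exp_quadratic {n : ℕ} {A : Matrix (Fin n) (Fin n) ℝ} (hA : A.PosDef) {N : ℝ}
    (hN : 0 < N) :
    ∫ z : Fin n → ℝ, Real.exp (-(N / 2) * (z ⬝ᵥ A *ᵥ z)) =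
      (√A.det)⁻¹ * ((2 * Real.pi) ^ ((n : ℝ) / 2) * N ^ (-((n : ℝ) / 2))) := by
  obtain ⟨M, hM, rfl⟩ := exists_transpose_mul_self hA
  simp only [dotProduct_transpose_mul_self]
  rw [integral_comp_mulVec hM (fun w => Real.exp (-(N / 2) * ∑ i, w i ^ 2)),
    integral_exp_neg_sum_sq, sqrt_two_pi_div_pow hN, det_mul, det_transpose,
    Real.sqrt_mul_self_eq_abs]

open Matrix in
lemma integral_quadratic_mul_exp_quadratic {n : ℕ} {A : Matrix (Fin n) (Fin n) ℝ}
    (hA : A.PosDef) (B : Matrix (Fin n) (Fin n) ℝ) {N : ℝ} (hN : 0 < N) :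
    ∫ z : Fin n → ℝ, (z ⬝ᵥ B *ᵥ z) * Real.exp (-(N / 2) * (z ⬝ᵥ A *ᵥ z)) =
      (√A.det)⁻¹ * ((B * A⁻¹).trace *
        ((2 * Real.pi) ^ ((n : ℝ) / 2) * N ^ (-((n : ℝ) / 2)) / N)) := by
  obtain ⟨M, hM, rfl⟩ := exists_transpose_mul_self hA
  have hu : IsUnit M.det := isUnit_iff_ne_zero.mpr hM
  have hB : ∀ z, z ⬝ᵥ B *ᵥ z = (M *ᵥ z) ⬝ᵥ ((M⁻¹)ᵀ * B * M⁻¹) *ᵥ (M *ᵥ z) := by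
    intro z
    rw [mulVec_mulVec, Matrix.mul_assoc, nonsing_inv_mul _ hu, Matrix.mul_one,
      ← mulVec_mulVec, dotProduct_mulVec (M *ᵥ z), vecMul_transpose, mulVec_mulVec,
      nonsing_inv_mul _ hu, one_mulVec]
  have htr : ((M⁻¹)ᵀ * B * M⁻¹).trace = (B * (Mᵀ * M)⁻¹).trace := by
    rw [Matrix.mul_inv_rev, ← transpose_nonsing_inv, ← Matrix.mul_assoc, trace_mul_comm (B * M⁻¹),
      Matrix.mul_assoc]
  simp only [dotProduct_transpose_mul_self, hB]
  rw [integral_comp_mulVec hM (fun w => (w ⬝ᵥ ((M⁻¹)ᵀ * B * M⁻¹) *ᵥ w) *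
      Real.exp (-(N / 2) * ∑ i, w i ^ 2)), integral_quadratic_mul_exp (by positivity),
    sqrt_two_pi_div_pow hN, det_mul, det_transpose, Real.sqrt_mul_self_eq_abs, htr]
  congr 3
  ring

lemma norm_sq_le_sum_sq {n : ℕ} (z : Fin n → ℝ) : ‖z‖ ^ 2 ≤ ∑ i, z i ^ 2 := by
  have h0 : 0 ≤ ∑ i, z i ^ 2 := Finset.sum_nonneg fun i _ => sq_nonneg _
  rw [← Real.sq_sqrt h0]
  refine pow_le_pow_left₀ (norm_nonneg _) ((pi_norm_le_iff_of_nonneg (Real.sqrt_nonneg _)).mpr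
    fun i => Real.abs_le_sqrt ?_) 2
  exact Finset.single_le_sum (f := fun i => z i ^ 2) (fun i _ => sq_nonneg _) (Finset.mem_univ i)

lemma _root_.Matrix.PosDef.exists_le_dotProduct_mulVec {n : ℕ} {A : Matrix (Fin n) (Fin n) ℝ}
    (hA : A.PosDef) : ∃ c > 0, ∀ z : Fin n → ℝ, c * ∑ i, z i ^ 2 ≤ z ⬝ᵥ A.mulVec z := by
  obtain ⟨M, hM, rfl⟩ := exists_transpose_mul_self hA
  have hu : IsUnit M.det := isUnit_iff_ne_zero.mpr hM
  set L : (Fin n → ℝ) →L[ℝ] (Fin n → ℝ) := (Matrix.toLin' M⁻¹).toContinuousLinearMap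
  refine ⟨(n * ‖L‖ ^ 2 + 1)⁻¹, by positivity, fun z => ?_⟩
  rw [dotProduct_transpose_mul_self, inv_mul_le_iff₀ (by positivity)]
  have hz : ‖z‖ ≤ ‖L‖ * ‖M.mulVec z‖ := by
    have h := L.le_opNorm (M.mulVec z)
    have h' : L (M.mulVec z) = z := by
      simp [L, Matrix.mulVec_mulVec, Matrix.nonsing_inv_mul _ hu]
    rwa [h'] at h
  calc ∑ i, z i ^ 2 ≤ ∑ _i : Fin n, ‖z‖ ^ 2 := by
        refine Finset.sum_le_sum fun i _ => ?_
        rw [← sq_abs]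
        exact pow_le_pow_left₀ (abs_nonneg _) (norm_le_pi_norm z i) 2
    _ = n * ‖z‖ ^ 2 := by simp
    _ ≤ n * (‖L‖ * ‖M.mulVec z‖) ^ 2 := by gcongr
    _ = n * ‖L‖ ^ 2 * ‖M.mulVec z‖ ^ 2 := by ring
    _ ≤ n * ‖L‖ ^ 2 * ∑ i, (M.mulVec z) i ^ 2 := by
        gcongr
        exact norm_sq_le_sum_sq _
    _ ≤ _ := by
        gcongr
        linarith

lemma integral_pow_mul_exp_neg_mul (m : ℕ) {r : ℝ} (hr : 0 < r) :
    ∫ x in Set.Ioi (0 : ℝ), x ^ m * Real.exp (-(r * x)) = (m ! : ℝ) / r ^ (m + 1) := by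
  have h := Real.integral_rpow_mul_exp_neg_mul_Ioi (a := m + 1) (by positivity) hr
  rw [Real.Gamma_nat_eq_factorial] at h
  simp only [add_sub_cancel_right, Real.rpow_natCast] at h
  rw [h, ← Nat.cast_succ, Real.rpow_natCast, one_div, inv_pow, div_eq_mul_inv, mul_comm]

lemma integrableOn_pow_mul_exp_neg_mul (m : ℕ) {r : ℝ} (hr : 0 < r) :
    IntegrableOn (fun x : ℝ => x ^ m * Real.exp (-(r * x))) (Set.Ioi 0) := by
  apply Integrable.of_integral_ne_zero
  rw [integral_pow_mul_exp_neg_mul m hr]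
  positivity

/-! ### The parabolic gauge and the closed domain -/

/-- The parabolic gauge `√(x + |z|²)` on `{x ≥ 0}`: weight two in `x` and weight one in `z`, the
scaling under which the two leading terms of the phase are balanced. -/
noncomputable def pGauge {n : ℕ} (p : ℝ × (Fin n → ℝ)) : ℝ :=
  √(p.1 + ∑ i, p.2 i ^ 2)

lemma pGauge_nonneg {n : ℕ} (p : ℝ × (Fin n → ℝ)) : 0 ≤ pGauge p := Real.sqrt_nonneg _

lemma pGauge_sq {n : ℕ} {p : ℝ × (Fin n → ℝ)} (hp : 0 ≤ p.1) :
    pGauge p ^ 2 = p.1 + ∑ i, p.2 i ^ 2 :=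
  Real.sq_sqrt (add_nonneg hp (Finset.sum_nonneg fun _ _ => sq_nonneg _))

@[fun_prop]
lemma continuous_gauge {n : ℕ} : Continuous (pGauge (n := n)) := by
  unfold pGauge
  fun_prop

lemma fst_le_gauge_sq {n : ℕ} {p : ℝ × (Fin n → ℝ)} (hp : 0 ≤ p.1) : p.1 ≤ pGauge p ^ 2 := by
  rw [pGauge_sq hp]
  exact le_add_of_nonneg_right (Finset.sum_nonneg fun _ _ => sq_nonneg _)

lemma norm_snd_le_gauge {n : ℕ} {p : ℝ × (Fin n → ℝ)} (hp : 0 ≤ p.1) : ‖p.2‖ ≤ pGauge p := by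
  refine le_of_sq_le_sq ?_ (pGauge_nonneg p)
  rw [pGauge_sq hp]
  exact (norm_sq_le_sum_sq p.2).trans (le_add_of_nonneg_left hp)

lemma closure_domain (n : ℕ) :
    closure (domain n) = Set.Icc (0 : ℝ) 1 ×ˢ Set.univ.pi fun _ => Set.Icc (-1 : ℝ) 1 := by
  rw [domain, closure_prod_eq, closure_pi_set, closure_Ioo zero_ne_one]
  simp only [closure_Ioo (show (-1 : ℝ) ≠ 1 by norm_num)]

lemma isCompact_closure_domain (n : ℕ) : IsCompact (closure (domain n)) := by
  rw [closure_domain]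
  exact isCompact_Icc.prod (isCompact_univ_pi fun _ => isCompact_Icc)

lemma zero_mem_closure_domain (n : ℕ) : (0 : ℝ × (Fin n → ℝ)) ∈ closure (domain n) := by
  rw [closure_domain]
  exact ⟨⟨le_rfl, zero_le_one⟩, fun i _ => ⟨by simp, by simp⟩⟩

lemma fst_nonneg {n : ℕ} {p : ℝ × (Fin n → ℝ)} (hp : p ∈ closure (domain n)) : 0 ≤ p.1 := by
  rw [closure_domain] at hp
  exact hp.1.1

lemma norm_le_gauge {n : ℕ} {p : ℝ × (Fin n → ℝ)} (hp : p ∈ closure (domain n)) :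
    ‖p‖ ≤ pGauge p := by
  have h0 := fst_nonneg hp
  rw [closure_domain] at hp
  refine max_le (le_of_sq_le_sq ?_ (pGauge_nonneg p)) (norm_snd_le_gauge h0)
  rw [Real.norm_eq_abs, sq_abs]
  refine le_trans ?_ (fst_le_gauge_sq h0)
  nlinarith [hp.1.2]

lemma pGauge_sq_le {n : ℕ} {p : ℝ × (Fin n → ℝ)} (hp : p ∈ closure (domain n)) :
    pGauge p ^ 2 ≤ 1 + n := by
  rw [pGauge_sq (fst_nonneg hp)]
  rw [closure_domain] at hp
  refine add_le_add hp.1.2 ?_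
  calc ∑ i, p.2 i ^ 2 ≤ ∑ _i : Fin n, (1 : ℝ) := Finset.sum_le_sum fun i _ => by
        obtain ⟨h1, h2⟩ := hp.2 i (Set.mem_univ i)
        nlinarith
    _ = n := by simp

/-- Away from the origin the gauge is bounded below, so on the compact closed domain a local bound
by a power of the gauge is a global one. -/
lemma exists_abs_le_gauge_pow {n : ℕ} {h : ℝ × (Fin n → ℝ) → ℝ}
    (hc : ContinuousOn h (closure (domain n))) (k : ℕ) {K : ℝ}
    (hloc : ∀ᶠ p in nhds 0, p ∈ closure (domain n) → |h p| ≤ K * pGauge p ^ k) :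
    ∃ K' ≥ 0, ∀ p ∈ closure (domain n), |h p| ≤ K' * pGauge p ^ k := by
  obtain ⟨δ, hδ, hball⟩ := Metric.eventually_nhds_iff.mp hloc
  obtain ⟨M, hM⟩ := (isCompact_closure_domain n).exists_bound_of_continuousOn hc
  have hM0 : 0 ≤ M := (norm_nonneg _).trans (hM 0 (zero_mem_closure_domain n))
  refine ⟨max |K| (M / δ ^ k), le_max_of_le_left (abs_nonneg _), fun p hp => ?_⟩
  have hg := pow_nonneg (pGauge_nonneg p) k
  rcases lt_or_ge ‖p‖ δ with hlt | hge
  · exact (hball (by simpa using hlt) hp).trans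
      (mul_le_mul_of_nonneg_right ((le_abs_self K).trans (le_max_left _ _)) hg)
  · calc |h p| ≤ M := hM p hp
      _ = M / δ ^ k * δ ^ k := by field_simp
      _ ≤ M / δ ^ k * pGauge p ^ k := by
          gcongr
          exact hge.trans (norm_le_gauge hp)
      _ ≤ _ := mul_le_mul_of_nonneg_right (le_max_right _ _) hg

/-! ### Weighted Taylor expansions at the origin -/

section Taylor

variable {E : Type*} [NormedAddCommGroup E] [NormedSpace ℝ E]

/-- The first three terms of a power series are those of the Taylor formula. -/
lemma coeff_eq_taylor {f : E → ℝ} {p : FormalMultilinearSeries ℝ E ℝ}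
    (hp : HasFPowerSeriesAt f p 0) (y : E) :
    p 0 (fun _ => y) = f 0 ∧ p 1 (fun _ => y) = fderiv ℝ f 0 y ∧
      p 2 (fun _ => y) = fderiv ℝ (fderiv ℝ f) 0 y y / 2 := by
  obtain ⟨r, hr⟩ := hp
  refine ⟨hr.coeff_zero _, ?_, ?_⟩
  · simpa using hr.factorial_smul y 1
  · have := hr.factorial_smul y 2
    rw [iteratedFDeriv_two_apply] at this
    rw [← this]
    simp

lemma exists_taylor_two {f : E → ℝ} (hf : AnalyticAt ℝ f 0) :
    ∃ K, ∀ᶠ y in nhds (0 : E), |f y - f 0 - fderiv ℝ f 0 y| ≤ K * ‖y‖ ^ 2 := by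
  obtain ⟨p, hp⟩ := hf
  obtain ⟨K, hK⟩ := (hp.isBigO_sub_partialSum_pow 2).bound
  refine ⟨K, hK.mono fun y hy => ?_⟩
  obtain ⟨h0, h1, -⟩ := coeff_eq_taylor hp y
  simp only [FormalMultilinearSeries.partialSum, Finset.sum_range_succ, Finset.sum_range_zero,
    zero_add, h0, h1, norm_pow, Real.norm_eq_abs, abs_norm] at hy
  rwa [sub_sub]

lemma exists_taylor_four {f : E → ℝ} (hf : AnalyticAt ℝ f 0) :
    ∃ (T : ContinuousMultilinearMap ℝ (fun _ : Fin 3 => E) ℝ) (K : ℝ), ∀ᶠ y in nhds (0 : E),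
      |f y - f 0 - fderiv ℝ f 0 y - fderiv ℝ (fderiv ℝ f) 0 y y / 2 - T (fun _ => y)| ≤
        K * ‖y‖ ^ 4 := by
  obtain ⟨p, hp⟩ := hf
  obtain ⟨K, hK⟩ := (hp.isBigO_sub_partialSum_pow 4).bound
  refine ⟨p 3, K, hK.mono fun y hy => ?_⟩
  obtain ⟨h0, h1, h2⟩ := coeff_eq_taylor hp y
  simp only [FormalMultilinearSeries.partialSum, Finset.sum_range_succ, Finset.sum_range_zero,
    zero_add, h0, h1, h2, norm_pow, Real.norm_eq_abs, abs_norm] at hy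
  convert hy using 2
  ring

end Taylor

section Hessian

variable {n : ℕ}

lemma inr_eq_sum (z : Fin n → ℝ) :
    ((0, z) : ℝ × (Fin n → ℝ)) = ∑ i, z i • (0, Pi.single i 1) := by
  ext j
  · simp [Prod.fst_sum]
  · simp [Prod.snd_sum, Finset.sum_apply, Pi.single_apply]

lemma fderiv_apply_eq (f : ℝ × (Fin n → ℝ) → ℝ) (y : ℝ × (Fin n → ℝ)) :
    fderiv ℝ f 0 y = partialX f (0, 0) * y.1 + fderiv ℝ f 0 (0, y.2) := by
  have : y = y.1 • (1, 0) + (0, y.2) := by ext <;> simp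
  conv_lhs => rw [this, map_add, map_smul]
  rw [smul_eq_mul, mul_comm]
  rfl

lemma fderiv_inr_eq_zero {f : ℝ × (Fin n → ℝ) → ℝ} (h : ∀ i, partialZ i f (0, 0) = 0)
    (z : Fin n → ℝ) : fderiv ℝ f 0 (0, z) = 0 := by
  rw [inr_eq_sum, map_sum]
  refine Finset.sum_eq_zero fun i _ => ?_
  rw [map_smul]
  have := h i
  rw [partialZ, Prod.mk_zero_zero] at this
  rw [this, smul_zero]

open Matrix in
lemma fderiv_fderiv_inr_eq {f : ℝ × (Fin n → ℝ) → ℝ} (hf : AnalyticAt ℝ f 0)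
    (z : Fin n → ℝ) :
    fderiv ℝ (fderiv ℝ f) 0 (0, z) (0, z) = z ⬝ᵥ hessianZ f (0, 0) *ᵥ z := by
  have hd : DifferentiableAt ℝ (fderiv ℝ f) 0 := hf.fderiv.differentiableAt
  have hH : ∀ i j, hessianZ f (0, 0) i j =
      fderiv ℝ (fderiv ℝ f) 0 (0, Pi.single i 1) (0, Pi.single j 1) := by
    intro i j
    have hj : partialZ j f = fun q => fderiv ℝ f q (0, Pi.single j 1) := rfl
    simp only [hessianZ, of_apply, partialZ.eq_def i, Prod.mk_zero_zero, hj]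
    rw [fderiv_clm_apply hd (differentiableAt_const _)]
    simp
  simp only [quadratic_eq_sum, hH]
  conv_lhs => rw [inr_eq_sum z]
  simp only [map_sum, map_smul, _root_.sum_apply, _root_.smul_apply,
    smul_eq_mul, Finset.mul_sum]
  rw [Finset.sum_comm]
  exact Finset.sum_congr rfl fun i _ => Finset.sum_congr rfl fun j _ => by ring

/-- First order expansion: up to gauge order two, an analytic function is its value at the origin
plus a part odd in `z`. -/
lemma exists_expansion_two {g : ℝ × (Fin n → ℝ) → ℝ}
    (hg : AnalyticOnNhd ℝ g (closure (domain n))) :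
    ∃ C : ℝ × (Fin n → ℝ) → ℝ, Continuous C ∧ (∀ p, C (p.1, -p.2) = -C p) ∧ ∃ K ≥ 0,
      (∀ p ∈ closure (domain n), |C p| ≤ K * pGauge p ^ 1) ∧
      ∀ p ∈ closure (domain n), |g p - g (0, 0) - C p| ≤ K * pGauge p ^ 2 := by
  have h0 := hg 0 (zero_mem_closure_domain n)
  obtain ⟨K, hK⟩ := exists_taylor_two h0
  set D := fderiv ℝ g 0
  have hCc : Continuous fun p : ℝ × (Fin n → ℝ) => D (0, p.2) := by fun_prop
  obtain ⟨K', hK'0, hK'⟩ := exists_abs_le_gauge_pow (K := |K| + |partialX g (0, 0)|)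
    (h := fun p => g p - g (0, 0) - D (0, p.2))
    ((hg.continuousOn.sub continuousOn_const).sub hCc.continuousOn) 2 (by
      filter_upwards [hK] with p hp hmem
      have e : g p - g (0, 0) - D (0, p.2) =
          (g p - g 0 - D p) + partialX g (0, 0) * p.1 := by
        rw [show D p = _ from fderiv_apply_eq g p, Prod.mk_zero_zero]
        ring
      rw [e, add_mul]
      refine (abs_add_le _ _).trans (add_le_add (hp.trans ?_) ?_)
      · exact mul_le_mul (le_abs_self K) (by gcongr; exact norm_le_gauge hmem) (by positivity)
          (abs_nonneg K)
      · rw [abs_mul, abs_of_nonneg (fst_nonneg hmem)]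
        gcongr
        exact fst_le_gauge_sq (fst_nonneg hmem))
  refine ⟨fun p => D (0, p.2), hCc, fun p => ?_, max ‖D‖ K', le_max_of_le_right hK'0,
    fun p hp => ?_, fun p hp => (hK' p hp).trans ?_⟩
  · rw [← map_neg]
    simp
  · rw [pow_one]
    refine (D.le_opNorm _).trans ?_
    have : ‖((0, p.2) : ℝ × (Fin n → ℝ))‖ ≤ pGauge p := by
      simpa using norm_snd_le_gauge (fst_nonneg hp)
    gcongr
    exact le_max_left _ _
  · gcongr
    exact le_max_right _ _

open Matrix in
/-- Second order expansion. In gauge order three only the monomials `x z_i` and `z_i z_j z_k`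
occur, all of them odd in `z`. -/
lemma exists_expansion_four {f : ℝ × (Fin n → ℝ) → ℝ}
    (hf : AnalyticOnNhd ℝ f (closure (domain n))) (hfz : ∀ i, partialZ i f (0, 0) = 0) :
    ∃ C : ℝ × (Fin n → ℝ) → ℝ, Continuous C ∧ (∀ p, C (p.1, -p.2) = -C p) ∧ ∃ K ≥ 0,
      (∀ p ∈ closure (domain n), |C p| ≤ K * pGauge p ^ 3) ∧
      ∀ p ∈ closure (domain n), |f p - f (0, 0) - (partialX f (0, 0) * p.1 +
        (p.2 ⬝ᵥ hessianZ f (0, 0) *ᵥ p.2) / 2) - C p| ≤ K * pGauge p ^ 4 := by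
  have h0 := hf 0 (zero_mem_closure_domain n)
  obtain ⟨T, K, hK⟩ := exists_taylor_four h0
  have hBz := fderiv_fderiv_inr_eq h0
  set B := fderiv ℝ (fderiv ℝ f) 0
  set e : ℝ × (Fin n → ℝ) := (1, 0)
  have he : ‖e‖ ≤ 1 := by simp [e]
  set C : ℝ × (Fin n → ℝ) → ℝ := fun p =>
    p.1 * (B e (0, p.2) + B (0, p.2) e) / 2 + T (fun _ => (0, p.2)) with hC
  have hCc : Continuous C := by
    have : Continuous fun p : ℝ × (Fin n → ℝ) => B (0, p.2) e := by fun_prop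
    fun_prop
  have hv : ∀ p ∈ closure (domain n), ‖((0, p.2) : ℝ × (Fin n → ℝ))‖ ≤ pGauge p := by
    intro p hp
    simpa using norm_snd_le_gauge (fst_nonneg hp)
  have hCodd : ∀ p, C (p.1, -p.2) = -C p := by
    intro p
    have h1 : ((0, -p.2) : ℝ × (Fin n → ℝ)) = -(0, p.2) := by simp
    have h2 : T (fun _ => -(0, p.2)) = -T (fun _ => (0, p.2)) := by
      have := T.map_smul_univ (fun _ => (-1 : ℝ)) (fun _ => (0, p.2))
      simpa [pow_succ] using this
    simp only [hC, h1, h2, map_neg, _root_.neg_apply]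
    ring
  have hrem : ∀ᶠ p in nhds (0 : ℝ × (Fin n → ℝ)), p ∈ closure (domain n) →
      |f p - f (0, 0) - (partialX f (0, 0) * p.1 +
        (p.2 ⬝ᵥ hessianZ f (0, 0) *ᵥ p.2) / 2) - C p| ≤
      (|K| + ‖B‖ + ‖T‖ * 3) * pGauge p ^ 4 := by
    filter_upwards [hK] with p hp hmem
    have hx := fst_nonneg hmem
    have hx2 := fst_le_gauge_sq hx
    have hdec : p = p.1 • e + (0, p.2) := by ext <;> simp [e]
    have hBp : B p p = p.1 ^ 2 * B e e + p.1 * (B e (0, p.2) + B (0, p.2) e) +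
        B (0, p.2) (0, p.2) := by
      conv_lhs => rw [hdec]
      simp only [map_add, map_smul, _root_.add_apply,
        _root_.smul_apply, smul_eq_mul]
      ring
    -- Splitting off the odd part `C` leaves the Taylor remainder, the monomial `x²`, and the cubic
    -- monomials divisible by `x`, all of gauge order at least four.
    have key : f p - f (0, 0) - (partialX f (0, 0) * p.1 +
        (p.2 ⬝ᵥ hessianZ f (0, 0) *ᵥ p.2) / 2) - C p =
        (f p - f 0 - fderiv ℝ f 0 p - B p p / 2 - T (fun _ => p)) +
          p.1 ^ 2 * B e e / 2 + (T (fun _ => p) - T (fun _ => (0, p.2))) := by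
      rw [fderiv_apply_eq, fderiv_inr_eq_zero hfz, hBp, hBz, hC, Prod.mk_zero_zero]
      ring
    rw [key, add_mul, add_mul]
    refine (abs_add_le _ _).trans (add_le_add ((abs_add_le _ _).trans
      (add_le_add (hp.trans ?_) ?_)) ?_)
    · exact mul_le_mul (le_abs_self K) (by gcongr; exact norm_le_gauge hmem) (by positivity)
          (abs_nonneg K)
    · have hb : |B e e| ≤ ‖B‖ := by
        refine (B.le_opNorm₂ e e).trans ?_
        calc ‖B‖ * ‖e‖ * ‖e‖ ≤ ‖B‖ * 1 * 1 := by gcongr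
          _ = ‖B‖ := by ring
      rw [abs_div, abs_mul, abs_of_nonneg (sq_nonneg p.1), abs_two]
      calc p.1 ^ 2 * |B e e| / 2 ≤ p.1 ^ 2 * |B e e| := half_le_self (by positivity)
        _ ≤ (pGauge p ^ 2) ^ 2 * ‖B‖ := by gcongr
        _ = ‖B‖ * pGauge p ^ 4 := by ring
    · refine (T.norm_image_sub_le _ _).trans ?_
      have h3 : (fun _ : Fin 3 => p) - (fun _ : Fin 3 => ((0, p.2) : ℝ × (Fin n → ℝ))) =
          fun _ => (p.1, 0) := by
        ext i <;> simp
      rw [h3]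
      simp only [pi_norm_const, Fintype.card_fin, Nat.cast_ofNat, Nat.add_one_sub_one]
      have h4 : ‖((p.1, 0) : ℝ × (Fin n → ℝ))‖ ≤ pGauge p ^ 2 := by
        simpa [abs_of_nonneg hx, sq_nonneg] using hx2
      calc _ ≤ ‖T‖ * 3 * pGauge p ^ 2 * pGauge p ^ 2 := by
            gcongr
            exact max_le (norm_le_gauge hmem) (hv p hmem)
        _ = _ := by ring
  obtain ⟨K', hK'0, hK'⟩ := exists_abs_le_gauge_pow
    (h := fun p => f p - f (0, 0) - (partialX f (0, 0) * p.1 +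
        (p.2 ⬝ᵥ hessianZ f (0, 0) *ᵥ p.2) / 2) - C p)
    (((hf.continuousOn.sub continuousOn_const).sub
      (by simp only [quadratic_eq_sum]; fun_prop)).sub hCc.continuousOn) 4 hrem
  refine ⟨C, hCc, hCodd, max (‖B‖ + ‖T‖) K', le_max_of_le_right hK'0, fun p hp => ?_,
    fun p hp => (hK' p hp).trans (by gcongr; exact le_max_right _ _)⟩
  have hσ := pGauge_nonneg p
  have hx := fst_nonneg hp
  have hb1 : |B e (0, p.2)| ≤ ‖B‖ * pGauge p := by
    refine (B.le_opNorm₂ _ _).trans ?_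
    calc _ ≤ ‖B‖ * 1 * pGauge p := by gcongr; exact hv p hp
      _ = _ := by ring
  have hb2 : |B (0, p.2) e| ≤ ‖B‖ * pGauge p := by
    refine (B.le_opNorm₂ _ _).trans ?_
    calc _ ≤ ‖B‖ * pGauge p * 1 := by gcongr; exact hv p hp
      _ = _ := by ring
  have hT : |T (fun _ => (0, p.2))| ≤ ‖T‖ * pGauge p ^ 3 := by
    refine (T.le_opNorm _).trans ?_
    simp only [Finset.prod_const, Finset.card_univ, Fintype.card_fin]
    gcongr
    exact hv p hp
  calc |C p| ≤ p.1 * |B e (0, p.2) + B (0, p.2) e| / 2 + |T (fun _ => (0, p.2))| := by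
        refine (abs_add_le _ _).trans (le_of_eq ?_)
        rw [abs_div, abs_mul, abs_two, abs_of_nonneg hx]
    _ ≤ pGauge p ^ 2 * (‖B‖ * pGauge p + ‖B‖ * pGauge p) / 2 + ‖T‖ * pGauge p ^ 3 := by
        gcongr
        · exact fst_le_gauge_sq hx
        · exact (abs_add_le _ _).trans (add_le_add hb1 hb2)
    _ = (‖B‖ + ‖T‖) * pGauge p ^ 3 := by ring
    _ ≤ _ := by
        gcongr
        exact le_max_left _ _

/-- At the boundary maximum the tangential gradient vanishes. -/
lemma partialZ_eq_zero_of_max {f : ℝ × (Fin n → ℝ) → ℝ}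
    (hf : DifferentiableAt ℝ f (0, 0))
    (hmax : ∀ p ∈ closure (domain n), f p ≤ f (0, 0)) (i : Fin n) :
    partialZ i f (0, 0) = 0 := by
  have hloc : IsLocalMax (fun z : Fin n → ℝ => f (0, z)) 0 := by
    have : Set.univ.pi (fun _ : Fin n => Set.Icc (-1 : ℝ) 1) ∈ nhds (0 : Fin n → ℝ) :=
      set_pi_mem_nhds Set.finite_univ fun i _ => Icc_mem_nhds (by simp) (by simp)
    filter_upwards [this] with z hz
    refine hmax _ ?_
    rw [closure_domain]
    exact ⟨by simp, hz⟩
  have hc : HasFDerivAt (fun z : Fin n → ℝ => f (0, z))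
      ((fderiv ℝ f (0, 0)).comp (ContinuousLinearMap.inr ℝ ℝ (Fin n → ℝ))) 0 :=
    HasFDerivAt.comp (f := fun z : Fin n → ℝ => ((0 : ℝ), z)) 0 hf.hasFDerivAt
      (ContinuousLinearMap.inr ℝ ℝ (Fin n → ℝ)).hasFDerivAt
  have := congrArg (fun L => L (Pi.single i (1 : ℝ))) (hloc.hasFDerivAt_eq_zero hc)
  simpa [partialZ] using this

end Hessian

/-! ### Pointwise comparison of the integrands -/

lemma exp_mul_sub_add_one_le (a b : ℝ) : Real.exp a * (b - a + 1) ≤ Real.exp b := by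
  calc _ ≤ Real.exp a * Real.exp (b - a) := by
        gcongr
        exact Real.add_one_le_exp _
    _ = _ := by rw [← Real.exp_add]; ring_nf

lemma abs_exp_sub_exp_le {a b M : ℝ} (ha : a ≤ M) (hb : b ≤ M) :
    |Real.exp a - Real.exp b| ≤ |a - b| * Real.exp M := by
  wlog h : b ≤ a generalizing a b
  · rw [abs_sub_comm, abs_sub_comm a]
    exact this hb ha (le_of_not_ge h)
  have h1 := exp_mul_sub_add_one_le a b
  rw [abs_of_nonneg (sub_nonneg.mpr (Real.exp_le_exp.mpr h)), abs_of_nonneg (sub_nonneg.mpr h)]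
  calc Real.exp a - Real.exp b ≤ (a - b) * Real.exp a := by linarith
    _ ≤ _ := mul_le_mul_of_nonneg_left (Real.exp_le_exp.mpr ha) (sub_nonneg.mpr h)

lemma abs_exp_sub_exp_sub_le {a b M : ℝ} (ha : a ≤ M) (hb : b ≤ M) :
    |Real.exp a - Real.exp b - (a - b) * Real.exp b| ≤ (a - b) ^ 2 * Real.exp M := by
  have h1 := exp_mul_sub_add_one_le a b
  have h2 := exp_mul_sub_add_one_le b a
  rw [abs_of_nonneg (by linarith)]
  calc _ ≤ (a - b) * (Real.exp a - Real.exp b) := by linarith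
    _ ≤ |a - b| * |Real.exp a - Real.exp b| := by
        rw [← abs_mul]
        exact le_abs_self _
    _ ≤ |a - b| * (|a - b| * Real.exp M) := by
        gcongr
        exact abs_exp_sub_exp_le ha hb
    _ = _ := by rw [← mul_assoc, abs_mul_abs_self, sq]

/-- Half of the exponential decay controls any power. -/
lemma pow_mul_exp_neg_le {c t : ℝ} (hc : 0 < c) (ht : 0 ≤ t) (j : ℕ) :
    t ^ j * Real.exp (-(c * t)) ≤ (j ! : ℝ) * (2 / c) ^ j * Real.exp (-(c / 2 * t)) := by
  have h := Real.pow_div_factorial_le_exp (x := c / 2 * t) (by positivity) j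
  rw [div_le_iff₀ (by positivity), mul_pow] at h
  have h' : t ^ j ≤ (j ! : ℝ) * (2 / c) ^ j * Real.exp (c / 2 * t) := by
    calc t ^ j = (2 / c) ^ j * ((c / 2) ^ j * t ^ j) := by
          rw [← mul_assoc, ← mul_pow]
          field_simp
          simp
      _ ≤ (2 / c) ^ j * (Real.exp (c / 2 * t) * j !) := by gcongr
      _ = _ := by ring
  calc _ ≤ (j ! : ℝ) * (2 / c) ^ j * Real.exp (c / 2 * t) * Real.exp (-(c * t)) := by gcongr
    _ = _ := by
        rw [mul_assoc _ (Real.exp _), ← Real.exp_add]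
        ring_nf

/-- Replacing phase and amplitude by their leading parts `F₀`, `G` and removing the first order
terms `O` and `N G C` (which are odd in the application) leaves an error of two further gauge
orders, up to powers of `N σ²`. -/
lemma abs_amplitude_sub_le {N c K K' σ F F₀ C G O g : ℝ} {k : ℕ} (hN : 0 ≤ N)
    (hF : F ≤ -(c * σ ^ 2)) (hF₀ : F₀ ≤ -(c * σ ^ 2))
    (hC : |F - F₀ - C| ≤ K * σ ^ 4) (hD : |F - F₀| ≤ K' * σ ^ 3)
    (hG : |G| ≤ K * σ ^ (2 * k)) (hO : |O| ≤ K * σ ^ (2 * k + 1))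
    (hg : |g - G - O| ≤ K * σ ^ (2 * k + 2)) :
    |g * Real.exp (N * F) - (O + N * G * C) * Real.exp (N * F₀) - G * Real.exp (N * F₀)| ≤
      σ ^ (2 * k + 2) * (K + (K * K' + K ^ 2) * (N * σ ^ 2) + K * K' ^ 2 * (N * σ ^ 2) ^ 2) *
        Real.exp (-(c * (N * σ ^ 2))) := by
  have hM : -(c * (N * σ ^ 2)) = N * -(c * σ ^ 2) := by ring
  rw [hM]
  set M := N * -(c * σ ^ 2)
  have h1 : N * F ≤ M := mul_le_mul_of_nonneg_left hF hN
  have h2 : N * F₀ ≤ M := mul_le_mul_of_nonneg_left hF₀ hN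
  have e1 : |(g - G - O) * Real.exp (N * F)| ≤ K * σ ^ (2 * k + 2) * Real.exp M := by
    rw [abs_mul, Real.abs_exp]
    gcongr
    exact (abs_nonneg _).trans hg
  have hd : |N * F - N * F₀| ≤ N * (K' * σ ^ 3) := by
    rw [← mul_sub, abs_mul, abs_of_nonneg hN]
    gcongr
  have e2 : |O * (Real.exp (N * F) - Real.exp (N * F₀))| ≤
      K * σ ^ (2 * k + 1) * (N * (K' * σ ^ 3) * Real.exp M) := by
    rw [abs_mul]
    refine mul_le_mul hO ((abs_exp_sub_exp_le h1 h2).trans ?_) (abs_nonneg _)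
      ((abs_nonneg _).trans hO)
    gcongr
  have e3 : |G * (Real.exp (N * F) - Real.exp (N * F₀) -
      (N * F - N * F₀) * Real.exp (N * F₀))| ≤
      K * σ ^ (2 * k) * ((N * (K' * σ ^ 3)) ^ 2 * Real.exp M) := by
    rw [abs_mul]
    refine mul_le_mul hG ((abs_exp_sub_exp_sub_le h1 h2).trans ?_) (abs_nonneg _)
      ((abs_nonneg _).trans hG)
    rw [← sq_abs]
    gcongr
  have e4 : |G * (N * (F - F₀ - C) * Real.exp (N * F₀))| ≤
      K * σ ^ (2 * k) * (N * (K * σ ^ 4) * Real.exp M) := by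
    rw [abs_mul, abs_mul, abs_mul, abs_of_nonneg hN, Real.abs_exp]
    have : 0 ≤ K * σ ^ 4 := (abs_nonneg _).trans hC
    gcongr
    exact (abs_nonneg _).trans hG
  calc _ = |(g - G - O) * Real.exp (N * F) + O * (Real.exp (N * F) - Real.exp (N * F₀)) +
        G * (Real.exp (N * F) - Real.exp (N * F₀) - (N * F - N * F₀) * Real.exp (N * F₀)) +
        G * (N * (F - F₀ - C) * Real.exp (N * F₀))| := by
        congr 1
        ring
    _ ≤ K * σ ^ (2 * k + 2) * Real.exp M +
        K * σ ^ (2 * k + 1) * (N * (K' * σ ^ 3) * Real.exp M) +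
        K * σ ^ (2 * k) * ((N * (K' * σ ^ 3)) ^ 2 * Real.exp M) +
        K * σ ^ (2 * k) * (N * (K * σ ^ 4) * Real.exp M) :=
      (abs_add_le _ _).trans (add_le_add ((abs_add_le _ _).trans
        (add_le_add ((abs_add_le _ _).trans (add_le_add e1 e2)) e3)) e4)
    _ = _ := by ring

/-- Absorbing powers of `N σ²` into half of the exponential decay: `σ ^ (2 k + 2)` is worth
`N ^ (-(k + 1))`. -/
lemma exists_gauge_pow_mul_exp_le {c : ℝ} (hc : 0 < c) (k : ℕ) {a₀ a₁ a₂ : ℝ} (h₀ : 0 ≤ a₀)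
    (h₁ : 0 ≤ a₁) (h₂ : 0 ≤ a₂) :
    ∃ L ≥ 0, ∀ N > 0, ∀ σ : ℝ, σ ^ (2 * k + 2) * (a₀ + a₁ * (N * σ ^ 2) +
      a₂ * (N * σ ^ 2) ^ 2) * Real.exp (-(c * (N * σ ^ 2))) ≤
        L / N ^ (k + 1) * Real.exp (-(c / 2 * (N * σ ^ 2))) := by
  refine ⟨a₀ * ((k + 1) ! * (2 / c) ^ (k + 1)) + a₁ * ((k + 2) ! * (2 / c) ^ (k + 2)) +
    a₂ * ((k + 3) ! * (2 / c) ^ (k + 3)), by positivity, fun N hN σ => ?_⟩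
  set t := N * σ ^ 2 with ht
  have ht0 : 0 ≤ t := by positivity
  have hσ : σ ^ (2 * k + 2) = t ^ (k + 1) / N ^ (k + 1) := by
    rw [ht, mul_pow, ← pow_mul, mul_add, mul_one]
    field_simp
  rw [hσ]
  calc _ = (a₀ * (t ^ (k + 1) * Real.exp (-(c * t))) + a₁ * (t ^ (k + 2) * Real.exp (-(c * t)))
        + a₂ * (t ^ (k + 3) * Real.exp (-(c * t)))) / N ^ (k + 1) := by ring
    _ ≤ (a₀ * ((k + 1) ! * (2 / c) ^ (k + 1) * Real.exp (-(c / 2 * t))) +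
        a₁ * ((k + 2) ! * (2 / c) ^ (k + 2) * Real.exp (-(c / 2 * t))) +
        a₂ * ((k + 3) ! * (2 / c) ^ (k + 3) * Real.exp (-(c / 2 * t)))) / N ^ (k + 1) := by
        have h := fun j => pow_mul_exp_neg_le hc ht0 j
        exact div_le_div_of_nonneg_right (add_le_add (add_le_add
          (mul_le_mul_of_nonneg_left (h _) h₀) (mul_le_mul_of_nonneg_left (h _) h₁))
          (mul_le_mul_of_nonneg_left (h _) h₂)) (by positivity)
    _ = _ := by ring

/-! ### Integration over the half space -/

/-- The half space `x > 0`. -/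
def halfSpace (n : ℕ) : Set (ℝ × (Fin n → ℝ)) := Set.Ioi 0 ×ˢ Set.univ

lemma measurableSet_halfSpace (n : ℕ) : MeasurableSet (halfSpace n) :=
  measurableSet_Ioi.prod MeasurableSet.univ

lemma measurableSet_domain (n : ℕ) : MeasurableSet (domain n) :=
  measurableSet_Ioo.prod (MeasurableSet.univ_pi fun _ => measurableSet_Ioo)

lemma domain_subset_halfSpace (n : ℕ) : domain n ⊆ halfSpace n :=
  fun _ hp => ⟨hp.1.1, trivial⟩

lemma one_le_gauge {n : ℕ} {p : ℝ × (Fin n → ℝ)} (hp : p ∈ halfSpace n) (hp' : p ∉ domain n) :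
    1 ≤ pGauge p := by
  have hx : 0 < p.1 := hp.1
  refine le_of_sq_le_sq ?_ (pGauge_nonneg p)
  rw [one_pow, pGauge_sq hx.le]
  by_contra! hlt
  have hs : ∀ i, 0 ≤ p.2 i ^ 2 := fun i => sq_nonneg _
  have hsum : 0 ≤ ∑ i, p.2 i ^ 2 := Finset.sum_nonneg fun i _ => hs i
  refine hp' ⟨⟨hx, by linarith⟩, fun i _ => ?_⟩
  have := Finset.single_le_sum (fun i _ => hs i) (Finset.mem_univ i)
  exact abs_lt.mp ((sq_lt_one_iff_abs_lt_one _).mp (by linarith))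

lemma integral_halfSpace (m n : ℕ) {r : ℝ} (hr : 0 < r) (u : (Fin n → ℝ) → ℝ) :
    ∫ p in halfSpace n, p.1 ^ m * Real.exp (-(r * p.1)) * u p.2 =
      (m ! : ℝ) / r ^ (m + 1) * ∫ z, u z := by
  rw [halfSpace, Measure.volume_eq_prod,
    setIntegral_prod_mul (fun x : ℝ => x ^ m * Real.exp (-(r * x))) u, Measure.restrict_univ,
    integral_pow_mul_exp_neg_mul m hr]

lemma pow_mul_exp_gauge_eq {n : ℕ} (m : ℕ) (r : ℝ) {p : ℝ × (Fin n → ℝ)} (hp : 0 ≤ p.1) :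
    p.1 ^ m * Real.exp (-(r * pGauge p ^ 2)) =
      p.1 ^ m * Real.exp (-(r * p.1)) * Real.exp (-r * ∑ i, p.2 i ^ 2) := by
  rw [pGauge_sq hp, mul_assoc, ← Real.exp_add]
  ring_nf

lemma integrableOn_pow_mul_exp_gauge (m n : ℕ) {r : ℝ} (hr : 0 < r) :
    IntegrableOn (fun p => p.1 ^ m * Real.exp (-(r * pGauge p ^ 2))) (halfSpace n) := by
  have h : IntegrableOn (fun p : ℝ × (Fin n → ℝ) =>
      p.1 ^ m * Real.exp (-(r * p.1)) * Real.exp (-r * ∑ i, p.2 i ^ 2)) (halfSpace n) := by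
    rw [IntegrableOn, halfSpace, Measure.volume_eq_prod, ← Measure.prod_restrict,
      Measure.restrict_univ]
    exact (integrableOn_pow_mul_exp_neg_mul m hr).mul_prod (integrable_exp_neg_sum_sq hr)
  exact h.congr_fun (fun p hp => (pow_mul_exp_gauge_eq m r hp.1.le).symm)
    (measurableSet_halfSpace n)

lemma integral_pow_mul_exp_gauge (m n : ℕ) {r : ℝ} (hr : 0 < r) :
    ∫ p in halfSpace n, p.1 ^ m * Real.exp (-(r * pGauge p ^ 2)) =
      (m ! : ℝ) / r ^ (m + 1) * √(Real.pi / r) ^ n := by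
  rw [← integral_exp_neg_sum_sq, ← integral_halfSpace m n hr]
  exact setIntegral_congr_fun (measurableSet_halfSpace n)
    fun p hp => pow_mul_exp_gauge_eq m r hp.1.le

lemma setIntegral_domain_eq_zero_of_odd {n : ℕ} {W : ℝ × (Fin n → ℝ) → ℝ}
    (hW : ∀ p, W (p.1, -p.2) = -W p) : ∫ p in domain n, W p = 0 := by
  have hmp : MeasurePreserving (fun p : ℝ × (Fin n → ℝ) => (p.1, -p.2)) :=
    (MeasurePreserving.id (volume : Measure ℝ)).prod
      (Measure.measurePreserving_neg (volume : Measure (Fin n → ℝ)))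
  have hemb : MeasurableEmbedding (fun p : ℝ × (Fin n → ℝ) => (p.1, -p.2)) :=
    ((MeasurableEquiv.refl ℝ).prodCongr (MeasurableEquiv.neg (Fin n → ℝ))).measurableEmbedding
  have hpre : (fun p : ℝ × (Fin n → ℝ) => (p.1, -p.2)) ⁻¹' domain n = domain n := by
    ext p
    simp only [domain, Set.mem_preimage, Set.mem_prod, Set.mem_pi, Set.mem_univ, true_imp_iff,
      Pi.neg_apply, Set.mem_Ioo, neg_lt_neg_iff]
    exact and_congr_right fun _ => forall_congr' fun i =>
      ⟨fun h => ⟨by linarith, by linarith⟩, fun h => ⟨by linarith, by linarith⟩⟩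
  have h := hmp.setIntegral_preimage_emb hemb W (domain n)
  rw [hpre] at h
  simp only [hW, integral_neg] at h
  linarith

lemma integrableOn_domain {n : ℕ} {W : ℝ × (Fin n → ℝ) → ℝ}
    (hW : ContinuousOn W (closure (domain n))) : IntegrableOn W (domain n) :=
  (hW.integrableOn_compact (isCompact_closure_domain n)).mono_set subset_closure

/-- The Laplace integral over the domain agrees with the integral of the leading parts over the
half space, up to a factor `N ^ (-(k + 1))` relative to `N ^ (-(m + 1) - n / 2)`. The first order
corrections `C` and `O` do not contribute because they are odd in `z`. -/
theorem exists_abs_integral_sub_le {n : ℕ} (m k : ℕ) {F F₀ C g G O : ℝ × (Fin n → ℝ) → ℝ}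
    {c K : ℝ} (hc : 0 < c) (hK : 0 ≤ K)
    (hFc : ContinuousOn F (closure (domain n))) (hgc : ContinuousOn g (closure (domain n)))
    (hF₀c : Continuous F₀) (hCc : Continuous C) (hGc : Continuous G) (hOc : Continuous O)
    (hF₀e : ∀ p, F₀ (p.1, -p.2) = F₀ p) (hCo : ∀ p, C (p.1, -p.2) = -C p)
    (hGe : ∀ p, G (p.1, -p.2) = G p) (hOo : ∀ p, O (p.1, -p.2) = -O p)
    (hF : ∀ p ∈ closure (domain n), F p ≤ -(c * pGauge p ^ 2))
    (hF₀ : ∀ p, 0 ≤ p.1 → F₀ p ≤ -(c * pGauge p ^ 2))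
    (hC : ∀ p ∈ closure (domain n), |F p - F₀ p - C p| ≤ K * pGauge p ^ 4)
    (hC' : ∀ p ∈ closure (domain n), |F p - F₀ p| ≤ K * pGauge p ^ 3)
    (hG : ∀ p, 0 ≤ p.1 → |G p| ≤ K * pGauge p ^ (2 * k))
    (hO : ∀ p ∈ closure (domain n), |O p| ≤ K * pGauge p ^ (2 * k + 1))
    (hg : ∀ p ∈ closure (domain n), |g p - G p - O p| ≤ K * pGauge p ^ (2 * k + 2)) :
    ∃ L, ∀ N > 0, |(∫ p in domain n, p.1 ^ m * g p * Real.exp (N * F p)) -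
      ∫ p in halfSpace n, p.1 ^ m * (G p * Real.exp (N * F₀ p))| ≤
        L * N ^ (-(m : ℝ) - (n : ℝ) / 2 - 2 - k) := by
  obtain ⟨L, hL0, hL⟩ := exists_gauge_pow_mul_exp_le hc k hK (a₁ := K * K + K ^ 2)
    (by positivity) (a₂ := K * K ^ 2) (by positivity)
  refine ⟨L * ((m ! : ℝ) / (c / 2) ^ (m + 1) * √(Real.pi / (c / 2)) ^ n), fun N hN => ?_⟩
  set W : ℝ × (Fin n → ℝ) → ℝ := fun p => (O p + N * G p * C p) * Real.exp (N * F₀ p) with hW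
  have hWc : Continuous W := by fun_prop
  have hWo : ∫ p in domain n, p.1 ^ m * W p = 0 := by
    refine setIntegral_domain_eq_zero_of_odd fun p => ?_
    simp only [hW, hF₀e, hCo, hGe, hOo]
    ring
  have hgF : ContinuousOn (fun p => p.1 ^ m * g p * Real.exp (N * F p)) (closure (domain n)) :=
    ((continuous_fst.pow m).continuousOn.mul hgc).mul
      (Real.continuous_exp.comp_continuousOn (continuousOn_const.mul hFc))
  have hWc' : ContinuousOn (fun p => p.1 ^ m * W p) (closure (domain n)) := by fun_prop
  -- The integrand minus its odd part, extended by zero to the half space: it has the same integral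
  -- as the original one, and is close to the Gaussian integrand `Γ` pointwise.
  set Φ : ℝ × (Fin n → ℝ) → ℝ := (domain n).indicator
    (fun p => p.1 ^ m * g p * Real.exp (N * F p) - p.1 ^ m * W p) with hΦ
  set Γ : ℝ × (Fin n → ℝ) → ℝ := fun p => p.1 ^ m * (G p * Real.exp (N * F₀ p)) with hΓ
  have hΦi : IntegrableOn Φ (halfSpace n) :=
    ((integrableOn_domain (hgF.sub hWc')).integrable_indicator
      (measurableSet_domain n)).integrableOn
  have hΦint : ∫ p in halfSpace n, Φ p =
      ∫ p in domain n, p.1 ^ m * g p * Real.exp (N * F p) := by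
    rw [hΦ, setIntegral_indicator (measurableSet_domain n),
      Set.inter_eq_right.mpr (domain_subset_halfSpace n),
      integral_sub (integrableOn_domain hgF) (integrableOn_domain hWc'), hWo, sub_zero]
  set r := c / 2 * N with hr
  have hr0 : 0 < r := by positivity
  have hwt := integrableOn_pow_mul_exp_gauge m n hr0
  have hΓi : IntegrableOn Γ (halfSpace n) := by
    refine Integrable.mono' (hwt.const_mul (K * ((k ! : ℝ) * (2 / c) ^ k / N ^ k)))
      (by fun_prop) ?_
    refine (ae_restrict_iff' (measurableSet_halfSpace n)).mpr (ae_of_all _ fun p hp => ?_)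
    have hx : 0 ≤ p.1 := hp.1.le
    have h1 := pow_mul_exp_neg_le hc (t := N * pGauge p ^ 2) (by positivity) k
    have h2 : Real.exp (N * F₀ p) ≤ Real.exp (-(c * (N * pGauge p ^ 2))) := by
      rw [Real.exp_le_exp]
      nlinarith [hF₀ p hx]
    rw [hΓ, Real.norm_eq_abs, abs_mul, abs_mul, Real.abs_exp, abs_of_nonneg (pow_nonneg hx m)]
    calc p.1 ^ m * (|G p| * Real.exp (N * F₀ p))
        ≤ p.1 ^ m * (K * pGauge p ^ (2 * k) * Real.exp (-(c * (N * pGauge p ^ 2)))) := by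
          exact mul_le_mul_of_nonneg_left (mul_le_mul (hG p hx) h2 (Real.exp_nonneg _)
            (mul_nonneg hK (pow_nonneg (pGauge_nonneg p) _))) (by positivity)
      _ = p.1 ^ m * (K * ((N * pGauge p ^ 2) ^ k *
            Real.exp (-(c * (N * pGauge p ^ 2)))) / N ^ k) := by
          rw [mul_pow, ← pow_mul]
          field_simp
      _ ≤ p.1 ^ m * (K * ((k ! : ℝ) * (2 / c) ^ k *
            Real.exp (-(c / 2 * (N * pGauge p ^ 2)))) / N ^ k) :=
          mul_le_mul_of_nonneg_left (div_le_div_of_nonneg_right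
            (mul_le_mul_of_nonneg_left h1 hK) (by positivity)) (by positivity)
      _ = _ := by
          rw [hr, mul_assoc (c / 2)]
          ring
  have hbound : ∀ p ∈ halfSpace n, ‖Φ p - Γ p‖ ≤
      L / N ^ (k + 1) * (p.1 ^ m * Real.exp (-(r * pGauge p ^ 2))) := by
    intro p hp
    have hx : 0 ≤ p.1 := hp.1.le
    have hσ := pGauge_nonneg p
    have hLp := hL N hN (pGauge p)
    rw [← mul_assoc (c / 2), ← hr] at hLp
    rw [mul_left_comm]
    by_cases hpD : p ∈ domain n
    · have hcl := subset_closure hpD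
      have hpt := abs_amplitude_sub_le hN.le (hF p hcl) (hF₀ p hx) (hC p hcl) (hC' p hcl)
        (hG p hx) (hO p hcl) (hg p hcl)
      have e : Φ p - Γ p = p.1 ^ m * (g p * Real.exp (N * F p) -
          (O p + N * G p * C p) * Real.exp (N * F₀ p) - G p * Real.exp (N * F₀ p)) := by
        rw [hΦ, Set.indicator_of_mem hpD]
        ring
      rw [e, Real.norm_eq_abs, abs_mul, abs_of_nonneg (pow_nonneg hx m)]
      gcongr
      exact hpt.trans hLp
    -- Outside the domain only `Γ` is left, and `σ ≥ 1` supplies the missing factor `σ²`.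
    · have h1 := one_le_gauge hp hpD
      have e : Φ p - Γ p = -(p.1 ^ m * (G p * Real.exp (N * F₀ p))) := by
        rw [hΦ, Set.indicator_of_notMem hpD, zero_sub]
      rw [e, norm_neg, Real.norm_eq_abs, abs_mul, abs_of_nonneg (pow_nonneg hx m)]
      gcongr
      refine le_trans ?_ hLp
      rw [abs_mul, Real.abs_exp]
      have h2 : Real.exp (N * F₀ p) ≤ Real.exp (-(c * (N * pGauge p ^ 2))) := by
        rw [Real.exp_le_exp]
        nlinarith [hF₀ p hx]
      have h3 : |G p| ≤ pGauge p ^ (2 * k + 2) * K := by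
        refine (hG p hx).trans ?_
        rw [mul_comm]
        exact mul_le_mul_of_nonneg_right (pow_le_pow_right₀ h1 (by omega)) hK
      refine mul_le_mul (h3.trans ?_) h2 (Real.exp_nonneg _) (by positivity)
      gcongr
      rw [add_assoc]
      exact le_add_of_nonneg_right (by positivity)
  have hfinal := norm_integral_le_of_norm_le (hwt.const_mul (L / N ^ (k + 1)))
    ((ae_restrict_iff' (measurableSet_halfSpace n)).mpr (ae_of_all _ hbound))
  rw [integral_sub hΦi hΓi, hΦint, integral_const_mul, integral_pow_mul_exp_gauge m n hr0,
    Real.norm_eq_abs] at hfinal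
  refine hfinal.trans (le_of_eq ?_)
  have hs : √(Real.pi / r) ^ n = √(Real.pi / (c / 2)) ^ n * N ^ (-((n : ℝ) / 2)) := by
    rw [hr, ← div_div, Real.sqrt_div (by positivity), div_pow, Real.sqrt_eq_rpow N,
      ← Real.rpow_natCast (N ^ _), ← Real.rpow_mul hN.le, Real.rpow_neg hN.le, div_eq_mul_inv]
    ring_nf
  have hexp : N ^ (-(m : ℝ) - (n : ℝ) / 2 - 2 - k) =
      (N ^ (k + 1))⁻¹ * (N ^ (m + 1))⁻¹ * N ^ (-((n : ℝ) / 2)) := by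
    rw [← Real.rpow_natCast, ← Real.rpow_natCast, ← Real.rpow_neg hN.le, ← Real.rpow_neg hN.le,
      ← Real.rpow_add hN, ← Real.rpow_add hN]
    congr 1
    push_cast
    ring
  rw [hs, hexp, hr, mul_pow]
  field_simp

/-! ### The asymptotic expansion -/

/-- A phase with its strict maximum at the origin lies below `-c σ²`: near the origin because its
leading part does, elsewhere by compactness. -/
lemma exists_le_neg_mul_gauge_sq {n : ℕ} {F F₀ : ℝ × (Fin n → ℝ) → ℝ} {c₀ K : ℝ}
    (hFc : ContinuousOn F (closure (domain n))) (hc₀ : 0 < c₀) (hK : 0 ≤ K)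
    (hmax : ∀ p ∈ closure (domain n), p ≠ 0 → F p < 0)
    (hF₀ : ∀ p, 0 ≤ p.1 → F₀ p ≤ -(c₀ * pGauge p ^ 2))
    (hD : ∀ p ∈ closure (domain n), |F p - F₀ p| ≤ K * pGauge p ^ 3) :
    ∃ c > 0, c ≤ c₀ ∧ ∀ p ∈ closure (domain n), F p ≤ -(c * pGauge p ^ 2) := by
  -- For `σ ≤ δ` the error `K σ³` is at most half of `c₀ σ²`.
  set δ := c₀ / (2 * (K + 1)) with hδ
  have hδ0 : 0 < δ := by positivity
  have hS : IsCompact (closure (domain n) ∩ {p | δ ≤ pGauge p}) :=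
    (isCompact_closure_domain n).inter_right (isClosed_le continuous_const continuous_gauge)
  obtain ⟨η, hη0, hη⟩ : ∃ η > 0, ∀ p ∈ closure (domain n) ∩ {p | δ ≤ pGauge p}, F p ≤ -η := by
    rcases Set.eq_empty_or_nonempty (closure (domain n) ∩ {p | δ ≤ pGauge p}) with he | hne
    · exact ⟨1, one_pos, by simp [he]⟩
    · obtain ⟨q, hq, hqm⟩ := hS.exists_isMaxOn hne (hFc.mono Set.inter_subset_left)
      refine ⟨-F q, neg_pos.mpr (hmax q hq.1 ?_), fun p hp => by simpa using hqm hp⟩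
      rintro rfl
      have : pGauge (0 : ℝ × (Fin n → ℝ)) = 0 := by simp [pGauge]
      have h := hq.2
      rw [Set.mem_ofPred_eq, this] at h
      exact absurd h (not_le.mpr hδ0)
  refine ⟨min (c₀ / 2) (η / (1 + n)), by positivity,
    (min_le_left _ _).trans (half_le_self hc₀.le), fun p hp => ?_⟩
  have hσ := pGauge_nonneg p
  rcases le_total δ (pGauge p) with hge | hle
  · have h1 : min (c₀ / 2) (η / (1 + n)) * pGauge p ^ 2 ≤ η / (1 + n) * (1 + n) :=
      mul_le_mul (min_le_right _ _) (pGauge_sq_le hp) (by positivity) (by positivity)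
    rw [div_mul_cancel₀ _ (by positivity)] at h1
    linarith [hη p ⟨hp, hge⟩]
  · have h1 : min (c₀ / 2) (η / (1 + n)) * pGauge p ^ 2 ≤ c₀ / 2 * pGauge p ^ 2 :=
      mul_le_mul_of_nonneg_right (min_le_left _ _) (by positivity)
    have h2 : K * pGauge p ≤ c₀ / 2 := by
      calc K * pGauge p ≤ (K + 1) * δ := mul_le_mul (by linarith) hle hσ (by linarith)
        _ = c₀ / 2 := by rw [hδ]; field_simp
    have h3 : K * pGauge p ^ 3 ≤ c₀ / 2 * pGauge p ^ 2 := by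
      calc K * pGauge p ^ 3 = K * pGauge p * pGauge p ^ 2 := by ring
        _ ≤ _ := mul_le_mul_of_nonneg_right h2 (by positivity)
    have := (abs_le.mp (hD p hp)).2
    linarith [hF₀ p (fst_nonneg hp)]

open Matrix in
/-- Reduction of the Laplace integral to a Gaussian integral in `z`, for an amplitude whose leading
part `G` is even in `z` of gauge order `2 k` and whose next order part `O` is odd in `z`. -/
theorem exists_abs_laplaceIntegral_sub_le {n : ℕ} (m k : ℕ) {f g : ℝ × (Fin n → ℝ) → ℝ}
    (hf : AnalyticOnNhd ℝ f (closure (domain n)))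
    (hmax : ∀ p ∈ closure (domain n), p ≠ (0, 0) → f p < f (0, 0))
    (hfzz : (-hessianZ f (0, 0)).PosDef) (hfx : partialX f (0, 0) < 0)
    (hgc : ContinuousOn g (closure (domain n)))
    {G : (Fin n → ℝ) → ℝ} {O : ℝ × (Fin n → ℝ) → ℝ} {K : ℝ} (hK : 0 ≤ K)
    (hGc : Continuous G) (hGe : ∀ z, G (-z) = G z)
    (hOc : Continuous O) (hOo : ∀ p, O (p.1, -p.2) = -O p)
    (hG : ∀ p : ℝ × (Fin n → ℝ), 0 ≤ p.1 → |G p.2| ≤ K * pGauge p ^ (2 * k))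
    (hO : ∀ p ∈ closure (domain n), |O p| ≤ K * pGauge p ^ (2 * k + 1))
    (hg : ∀ p ∈ closure (domain n), |g p - G p.2 - O p| ≤ K * pGauge p ^ (2 * k + 2)) :
    ∃ L, ∀ N > 0, |laplaceIntegral m f g N - Real.exp (N * f (0, 0)) *
      ((m ! : ℝ) / (N * -partialX f (0, 0)) ^ (m + 1) *
        ∫ z, G z * Real.exp (-(N / 2) * (z ⬝ᵥ -hessianZ f (0, 0) *ᵥ z)))| ≤
      L * (Real.exp (N * f (0, 0)) * N ^ (-(m : ℝ) - (n : ℝ) / 2 - 2 - k)) := by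
  have hfz : ∀ i, partialZ i f (0, 0) = 0 := partialZ_eq_zero_of_max
    (hf 0 (zero_mem_closure_domain n)).differentiableAt fun p hp => by
      rcases eq_or_ne p (0, 0) with rfl | hne
      · exact le_rfl
      · exact (hmax p hp hne).le
  obtain ⟨C, hCc, hCo, Kf, hKf, hC, hCrem⟩ := exists_expansion_four hf hfz
  obtain ⟨c₁, hc₁, hcoer⟩ := hfzz.exists_le_dotProduct_mulVec
  set a := partialX f (0, 0)
  set A := -hessianZ f (0, 0) with hA
  have hH : ∀ z : Fin n → ℝ, z ⬝ᵥ hessianZ f (0, 0) *ᵥ z = -(z ⬝ᵥ A *ᵥ z) := by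
    intro z
    rw [hA, neg_mulVec, dotProduct_neg, neg_neg]
  simp only [hH] at hCrem
  set F : ℝ × (Fin n → ℝ) → ℝ := fun p => f p - f (0, 0) with hF
  set F₀ : ℝ × (Fin n → ℝ) → ℝ := fun p => a * p.1 + -(p.2 ⬝ᵥ A *ᵥ p.2) / 2 with hF₀
  have hFc : ContinuousOn F (closure (domain n)) := hf.continuousOn.sub continuousOn_const
  have hF₀c : Continuous F₀ := by
    simp only [hF₀, quadratic_eq_sum]
    fun_prop
  have hσ1 : ∀ p ∈ closure (domain n), pGauge p ≤ 1 + n := fun p hp => by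
    refine le_of_sq_le_sq ((pGauge_sq_le hp).trans ?_) (by positivity)
    have : (0 : ℝ) ≤ n := Nat.cast_nonneg n
    nlinarith
  have hD : ∀ p ∈ closure (domain n), |F p - F₀ p| ≤ Kf * (2 + n) * pGauge p ^ 3 := by
    intro p hp
    have hσ := pGauge_nonneg p
    calc |F p - F₀ p| = |(F p - F₀ p - C p) + C p| := by rw [sub_add_cancel]
      _ ≤ Kf * pGauge p ^ 4 + Kf * pGauge p ^ 3 :=
          (abs_add_le _ _).trans (add_le_add (hCrem p hp) (hC p hp))
      _ = Kf * (pGauge p + 1) * pGauge p ^ 3 := by ring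
      _ ≤ _ := by
          refine mul_le_mul_of_nonneg_right (mul_le_mul_of_nonneg_left ?_ hKf) (by positivity)
          linarith [hσ1 p hp]
  have hF₀le : ∀ p, 0 ≤ p.1 → F₀ p ≤ -(min (-a) (c₁ / 2) * pGauge p ^ 2) := by
    intro p hp
    have hs : 0 ≤ ∑ i, p.2 i ^ 2 := Finset.sum_nonneg fun i _ => sq_nonneg _
    rw [pGauge_sq hp, mul_add]
    have h1 := mul_le_mul_of_nonneg_right (min_le_left (-a) (c₁ / 2)) hp
    have h2 := mul_le_mul_of_nonneg_right (min_le_right (-a) (c₁ / 2)) hs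
    have h3 := hcoer p.2
    simp only [hF₀]
    linarith
  obtain ⟨c, hc, hcc, hFle⟩ := exists_le_neg_mul_gauge_sq hFc
    (lt_min (neg_pos.mpr hfx) (half_pos hc₁)) (by positivity : 0 ≤ Kf * (2 + n))
    (fun p hp hp0 => sub_neg.mpr (hmax p hp hp0)) hF₀le hD
  have hKfn : Kf ≤ Kf * (2 + n) :=
    le_mul_of_one_le_right hKf (by linarith [(Nat.cast_nonneg n : (0 : ℝ) ≤ n)])
  have hKK : K ≤ Kf * (2 + n) + K := le_add_of_nonneg_left (by positivity)
  have hmono : ∀ {K₁ t : ℝ} {p : ℝ × (Fin n → ℝ)} {j : ℕ}, t ≤ K₁ * pGauge p ^ j →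
      K₁ ≤ Kf * (2 + n) + K → t ≤ (Kf * (2 + n) + K) * pGauge p ^ j := fun h h' =>
    h.trans (mul_le_mul_of_nonneg_right h' (pow_nonneg (pGauge_nonneg _) _))
  obtain ⟨L, hL⟩ := exists_abs_integral_sub_le m k (F := F) (F₀ := F₀) (C := C) (g := g)
    (G := fun p => G p.2) (O := O) hc (by positivity : 0 ≤ Kf * (2 + n) + K) hFc hgc hF₀c hCc
    (by fun_prop) hOc (fun p => by simp [hF₀, mulVec_neg]) hCo (fun p => hGe p.2) hOo hFle
    (fun p hp => (hF₀le p hp).trans (neg_le_neg (mul_le_mul_of_nonneg_right hcc (by positivity))))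
    (fun p hp => hmono (hCrem p hp) (by linarith)) (fun p hp => hmono (hD p hp) (by linarith))
    (fun p hp => hmono (hG p hp) hKK) (fun p hp => hmono (hO p hp) hKK)
    (fun p hp => hmono (hg p hp) hKK)
  refine ⟨L, fun N hN => ?_⟩
  have hI : laplaceIntegral m f g N = Real.exp (N * f (0, 0)) *
      ∫ p in domain n, p.1 ^ m * g p * Real.exp (N * F p) := by
    rw [laplaceIntegral, ← integral_const_mul]
    congr 1
    ext p
    rw [integrand, mul_left_comm, ← Real.exp_add]
    simp only [hF]
    ring_nf
  have hJ : ∫ p in halfSpace n, p.1 ^ m * (G p.2 * Real.exp (N * F₀ p)) =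
      (m ! : ℝ) / (N * -a) ^ (m + 1) * ∫ z, G z * Real.exp (-(N / 2) * (z ⬝ᵥ A *ᵥ z)) := by
    rw [← integral_halfSpace m n (mul_pos hN (neg_pos.mpr hfx))]
    congr 1
    ext p
    have : N * F₀ p = -(N * -a * p.1) + -(N / 2) * (p.2 ⬝ᵥ A *ᵥ p.2) := by
      simp only [hF₀]
      ring
    rw [this, Real.exp_add]
    ring
  rw [hI, ← hJ, ← mul_sub, abs_mul, Real.abs_exp, mul_left_comm]
  exact mul_le_mul_of_nonneg_left (hL N hN) (Real.exp_nonneg _)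

lemma sqrt_abs_det_eq {n : ℕ} {H : Matrix (Fin n) (Fin n) ℝ} (hH : (-H).PosDef) :
    √|H.det| = √(-H).det := by
  rw [← abs_of_pos hH.det_pos, Matrix.det_neg, abs_mul, abs_pow, abs_neg, abs_one, one_pow,
    one_mul]

lemma trace_mul_inv_neg {n : ℕ} (B : Matrix (Fin n) (Fin n) ℝ) {H : Matrix (Fin n) (Fin n) ℝ}
    (hH : (-H).PosDef) : (B * (-H)⁻¹).trace = (-B * H⁻¹).trace := by
  have hu : IsUnit H.det := by
    have := hH.det_pos.ne'
    rw [Matrix.det_neg] at this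
    exact isUnit_iff_ne_zero.mpr (right_ne_zero_of_mul this)
  have : (-H)⁻¹ = -H⁻¹ := Matrix.inv_eq_right_inv (by
    rw [neg_mul_neg, Matrix.mul_nonsing_inv _ hu])
  rw [this, Matrix.mul_neg, Matrix.neg_mul]

open Matrix in
lemma abs_quadratic_le {n : ℕ} (B : Matrix (Fin n) (Fin n) ℝ) {p : ℝ × (Fin n → ℝ)}
    (hp : 0 ≤ p.1) : |p.2 ⬝ᵥ B *ᵥ p.2| ≤ (∑ i, ∑ j, |B i j|) * pGauge p ^ 2 := by
  have hz : ∀ i, |p.2 i| ≤ pGauge p := fun i =>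
    (norm_le_pi_norm p.2 i).trans (norm_snd_le_gauge hp)
  rw [quadratic_eq_sum, Finset.sum_mul]
  refine (Finset.abs_sum_le_sum_abs _ _).trans (Finset.sum_le_sum fun i _ => ?_)
  rw [Finset.sum_mul]
  refine (Finset.abs_sum_le_sum_abs _ _).trans (Finset.sum_le_sum fun j _ => ?_)
  rw [abs_mul, abs_mul, sq]
  have := pGauge_nonneg p
  gcongr <;> exact hz _

lemma rpow_eq_rpow_div_pow {N : ℝ} (hN : 0 < N) (n m : ℕ) :
    N ^ (-(m : ℝ) - (n : ℝ) / 2 - 1) = N ^ (-((n : ℝ) / 2)) / N ^ (m + 1) := by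
  rw [← Real.rpow_natCast, ← Real.rpow_sub hN]
  push_cast
  ring_nf

end HalfSpaceLaplace

theorem mainTheorem1 (n m : ℕ) (f g : ℝ × (Fin n → ℝ) → ℝ)
    (hf : AnalyticOnNhd ℝ f (closure (HalfSpaceLaplace.domain n)))
    (hg : AnalyticOnNhd ℝ g (closure (HalfSpaceLaplace.domain n)))
    (hmax : ∀ p ∈ closure (HalfSpaceLaplace.domain n), p ≠ (0, 0) → f p < f (0, 0))
    (hfzz : (-HalfSpaceLaplace.hessianZ f (0, 0)).PosDef)
    (hfx : HalfSpaceLaplace.partialX f (0, 0) < 0) :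
    (∀ N : ℝ, IntegrableOn (HalfSpaceLaplace.integrand m f g N) (HalfSpaceLaplace.domain n)) ∧
    (g (0, 0) ≠ 0 →
      (fun N : ℝ => HalfSpaceLaplace.laplaceIntegral m f g N -
        g (0, 0) * (m ! : ℝ) * (2 * Real.pi) ^ ((n : ℝ) / 2) * Real.exp (N * f (0, 0)) *
            N ^ (-(m : ℝ) - (n : ℝ) / 2 - 1) /
          (Real.sqrt |(HalfSpaceLaplace.hessianZ f (0, 0)).det| *
            (-HalfSpaceLaplace.partialX f (0, 0)) ^ (m + 1)))
      =O[atTop] (fun N : ℝ =>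
        Real.exp (N * f (0, 0)) * N ^ (-(m : ℝ) - (n : ℝ) / 2 - 2))) ∧
    (g (0, 0) = 0 → HalfSpaceLaplace.partialX g (0, 0) = 0 →
      (∀ i, HalfSpaceLaplace.partialZ i g (0, 0) = 0) →
      (fun N : ℝ => HalfSpaceLaplace.laplaceIntegral m f g N -
        (-HalfSpaceLaplace.hessianZ g (0, 0) * (HalfSpaceLaplace.hessianZ f (0, 0))⁻¹).trace *
              (m ! : ℝ) * (2 * Real.pi) ^ ((n : ℝ) / 2) /
            (2 * Real.sqrt |(HalfSpaceLaplace.hessianZ f (0, 0)).det| *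
              (-HalfSpaceLaplace.partialX f (0, 0)) ^ (m + 1)) *
          Real.exp (N * f (0, 0)) * N ^ (-(m : ℝ) - (n : ℝ) / 2 - 2))
      =O[atTop] (fun N : ℝ =>
        Real.exp (N * f (0, 0)) * N ^ (-(m : ℝ) - (n : ℝ) / 2 - 3))) := by
  open HalfSpaceLaplace Matrix in
  have ha : 0 < -partialX f (0, 0) := neg_pos.mpr hfx
  have hdet : 0 < √(-hessianZ f (0, 0)).det := Real.sqrt_pos.mpr hfzz.det_pos
  refine ⟨fun N => ?_, fun _ => ?_, fun hg0 hgx hgz => ?_⟩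
  · exact integrableOn_domain (((continuous_fst.pow m).continuousOn.mul hg.continuousOn).mul
      (Real.continuous_exp.comp_continuousOn (continuousOn_const.mul hf.continuousOn)))
  · obtain ⟨O, hOc, hOo, K, hK, hO, hrem⟩ := exists_expansion_two hg
    obtain ⟨L, hL⟩ := exists_abs_laplaceIntegral_sub_le m 0 hf hmax hfzz hfx hg.continuousOn
      (G := fun _ => g (0, 0)) (O := O) (K := max K |g (0, 0)|) (le_max_of_le_left hK)
      continuous_const (fun _ => rfl) hOc hOo (fun p _ => by simp)
      (fun p hp => (hO p hp).trans (mul_le_mul_of_nonneg_right (le_max_left _ _)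
        (pow_nonneg (pGauge_nonneg p) _)))
      (fun p hp => (hrem p hp).trans (mul_le_mul_of_nonneg_right (le_max_left _ _)
        (pow_nonneg (pGauge_nonneg p) _)))
    refine IsBigO.of_bound L ((eventually_gt_atTop 0).mono fun N hN => ?_)
    have h := hL N hN
    rw [integral_const_mul, integral_exp_quadratic hfzz hN, Nat.cast_zero, sub_zero] at h
    rw [Real.norm_eq_abs, Real.norm_of_nonneg (by positivity)]
    convert h using 3
    rw [sqrt_abs_det_eq hfzz, rpow_eq_rpow_div_pow hN, mul_pow]
    field_simp
  · obtain ⟨O, hOc, hOo, K, hK, hO, hrem⟩ := exists_expansion_four hg hgz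
    set S := ∑ i, ∑ j, |hessianZ g (0, 0) i j|
    obtain ⟨L, hL⟩ := exists_abs_laplaceIntegral_sub_le m 1 hf hmax hfzz hfx hg.continuousOn
      (G := fun z => (z ⬝ᵥ hessianZ g (0, 0) *ᵥ z) * 2⁻¹) (O := O) (K := max K S)
      (le_max_of_le_left hK) (by simp only [quadratic_eq_sum]; fun_prop)
      (fun z => by simp [mulVec_neg]) hOc hOo
      (fun p hp => by
        have h1 := abs_quadratic_le (hessianZ g (0, 0)) hp
        have h2 : S * pGauge p ^ 2 ≤ max K S * pGauge p ^ 2 :=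
          mul_le_mul_of_nonneg_right (le_max_right _ _) (sq_nonneg _)
        rw [abs_mul, abs_of_pos (by norm_num : (0 : ℝ) < 2⁻¹), mul_one]
        linarith [abs_nonneg (p.2 ⬝ᵥ hessianZ g (0, 0) *ᵥ p.2)])
      (fun p hp => (hO p hp).trans (mul_le_mul_of_nonneg_right (le_max_left _ _)
        (pow_nonneg (pGauge_nonneg p) _)))
      (fun p hp => by
        have h1 := hrem p hp
        rw [hg0, hgx, zero_mul, zero_add, sub_zero, div_eq_mul_inv] at h1
        exact h1.trans (mul_le_mul_of_nonneg_right (le_max_left _ _)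
          (pow_nonneg (pGauge_nonneg p) _)))
    refine IsBigO.of_bound L ((eventually_gt_atTop 0).mono fun N hN => ?_)
    have h := hL N hN
    simp only [mul_right_comm _ (2⁻¹ : ℝ)] at h
    rw [integral_mul_const, integral_quadratic_mul_exp_quadratic hfzz _ hN,
      trace_mul_inv_neg _ hfzz, Nat.cast_one,
      show -(m : ℝ) - (n : ℝ) / 2 - 2 - 1 = -(m : ℝ) - (n : ℝ) / 2 - 3 by ring] at h
    rw [Real.norm_eq_abs, Real.norm_of_nonneg (by positivity)]
    convert h using 3
    rw [sqrt_abs_det_eq hfzz,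
      show -(m : ℝ) - (n : ℝ) / 2 - 2 = -(m : ℝ) - (n : ℝ) / 2 - 1 - 1 by ring,
      Real.rpow_sub_one hN.ne', rpow_eq_rpow_div_pow hN, mul_pow]
    field_simp
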